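/- Let $n\ge 1$. Let $\mathbf{Tam}_n$ be the Tamari lattice, i.e. the set of plane binary trees with $n$ internal vertices, partially ordered by the reflexive transitive closure of the rotation of binary trees (replacing at some vertex a subtree of the form $a\,(b\,c)$ by $(a\,b)\,c$), so that the right comb is the minimum and the left comb is the maximum. Write $s\triangleleft t$ when $t$ covers $s$. Let $\operatorname{Int}(\mathbf{Tam}_n)$ be the set of intervals of $\mathbf{Tam}_n$, i.e. pairs $(u,v)$ with $u\le v$, ordered componentwise: $(u,v)\le(u',v')$ if and only if $u\le u'$ and $v\le v'$. To each interval $(u,v)$ associate the monomial in four variables $x,y,\overline y,\overline x$ whose exponents count the edges incident to $(u,v)$ in the Hasse diagram of $\operatorname{Int}(\mathbf{Tam}_n)$, as follows: - $x$: outgoing edges $(u,v)\triangleleft(u',v)$ with $u\triangleleft u'\le v$; - $y$: outgoing edges $(u,v)\triangleleft(u,v')$ with $v\triangleleft v'$; - $\overline y$: incoming edges $(u',v)\triangleleft(u,v)$ with $u'\triangleleft u$; - $\overline x$: incoming edges $(u,v')\triangleleft(u,v)$ with $u\le v'\triangleleft v$. Then the number of intervals of $\mathbf{Tam}_n$ whose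 monomial has total degree $n-1$ in $(x,\overline y)$ and also total degree $n-1$ in $(\overline x,y)$ is the Motzkin number $M_{n-1}$ (OEIS A001006), where $M_0=1$ and $M_{m+1}=M_m+\sum_{k=0}^{m-1}M_k\,M_{m-1-k}$ for $m\ge 0$ (so $M_0,M_1,M_2,\dots=1,1,2,4,9,21,51,\dots$). -/

import Mathlib

/-! ### The poset of intervals of a poset, and the degrees of an interval -/

/-- The intervals `(u, v)`, `u ≤ v`, of a poset `P`. As a subtype of `P × P` this carries the
componentwise order: `(u, v) ≤ (u', v')` iff `u ≤ u'` and `v ≤ v'`. -/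
abbrev IntervalPoset (P : Type*) [PartialOrder P] : Type _ := {p : P × P // p.1 ≤ p.2}

namespace IntervalPoset

/-- The four variables, that is, the four types of edges at a vertex of the Hasse diagram of
the poset of intervals. -/
inductive EdgeType
  | x
  | y
  | ybar
  | xbar
  deriving DecidableEq

variable {P : Type*} [PartialOrder P]

/-- The minimum `u` of the interval `(u, v)`. -/
abbrev lo (I : IntervalPoset P) : P := I.1.1

/-- The maximum `v` of the interval `(u, v)`. -/
abbrev hi (I : IntervalPoset P) : P := I.1.2

/-- The edges of a given type that are incident to `I = (u, v)` in the Hasse diagram of the poset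
of intervals, each recorded by its other end:
* `x`: outgoing edges `(u, v) ⋖ (u', v)` with `u ⋖ u' ≤ v`;
* `y`: outgoing edges `(u, v) ⋖ (u, v')` with `v ⋖ v'`;
* `ybar`: incoming edges `(u', v) ⋖ (u, v)` with `u' ⋖ u`;
* `xbar`: incoming edges `(u, v') ⋖ (u, v)` with `u ≤ v' ⋖ v`. -/
def edges (I : IntervalPoset P) : EdgeType → Set (IntervalPoset P)
  | .x => {J | I ⋖ J ∧ I.lo ⋖ J.lo ∧ J.hi = I.hi}
  | .y => {J | I ⋖ J ∧ J.lo = I.lo ∧ I.hi ⋖ J.hi}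
  | .ybar => {J | J ⋖ I ∧ J.lo ⋖ I.lo ∧ J.hi = I.hi}
  | .xbar => {J | J ⋖ I ∧ J.lo = I.lo ∧ J.hi ⋖ I.hi}

/-- The exponent of each variable in the monomial of the interval `I`: the number of edges of the
corresponding type at `I`. -/
noncomputable def exponent (I : IntervalPoset P) (e : EdgeType) : ℕ := (I.edges e).ncard

/-- The total degree of the monomial of `I` with respect to a set of variables. -/
noncomputable def degree (S : Finset EdgeType) (I : IntervalPoset P) : ℕ := ∑ e ∈ S, I.exponent e

end IntervalPoset

/-! ### The Tamari lattices -/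

namespace Tamari

open BinaryTree

/-- `Rotation s t`: the plane binary tree `t` is obtained from `s` by one rotation
`a (b c) → (a b) c` at some vertex. -/
inductive Rotation : BinaryTree Unit → BinaryTree Unit → Prop
  | root (a b c : BinaryTree Unit) :
      Rotation (node () a (node () b c)) (node () (node () a b) c)
  | left {a a' : BinaryTree Unit} (b : BinaryTree Unit) :
      Rotation a a' → Rotation (node () a b) (node () a' b)
  | right (a : BinaryTree Unit) {b b' : BinaryTree Unit} :
      Rotation b b' → Rotation (node () a b) (node () a b')

/-- The sum over the vertices of the sizes of their left subtrees. -/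
def leftWeight : BinaryTree Unit → ℕ
  | nil => 0
  | node _ a b => a.numNodes + leftWeight a + leftWeight b

theorem Rotation.numNodes_eq {s t : BinaryTree Unit} (h : Rotation s t) :
    s.numNodes = t.numNodes := by
  induction h with
  | root a b c => simp only [numNodes]; omega
  | left b _ ih => simp only [numNodes]; omega
  | right a _ ih => simp only [numNodes]; omega

theorem Rotation.leftWeight_lt {s t : BinaryTree Unit} (h : Rotation s t) :
    leftWeight s < leftWeight t := by
  induction h with
  | root a b c => simp only [leftWeight, numNodes]; omega
  | left b h ih => have := h.numNodes_eq; simp only [leftWeight]; omega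
  | right a _ ih => simp only [leftWeight]; omega

theorem eq_or_leftWeight_lt {s t : BinaryTree Unit} (h : Relation.ReflTransGen Rotation s t) :
    s = t ∨ leftWeight s < leftWeight t := by
  induction h with
  | refl => exact Or.inl rfl
  | tail _ hr ih =>
    have := hr.leftWeight_lt
    rcases ih with rfl | ih
    · exact Or.inr this
    · exact Or.inr (ih.trans this)

end Tamari

/-- The underlying set of the Tamari lattice: plane binary trees with `n` internal vertices. -/
def Tam (n : ℕ) : Type := {t : BinaryTree Unit // t.numNodes = n}

/-- The Tamari order: the reflexive transitive closure of rotation. Its minimum is the right comb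
and its maximum the left comb. -/
instance Tam.instPartialOrder (n : ℕ) : PartialOrder (Tam n) where
  le s t := Relation.ReflTransGen Tamari.Rotation s.1 t.1
  le_refl _ := Relation.ReflTransGen.refl
  le_trans _ _ _ h₁ h₂ := Relation.ReflTransGen.trans h₁ h₂
  le_antisymm s t h₁ h₂ := by
    rcases Tamari.eq_or_leftWeight_lt h₁ with h | h
    · exact Subtype.ext h
    rcases Tamari.eq_or_leftWeight_lt h₂ with h' | h'
    · exact Subtype.ext h'.symm
    · omega

instance Tam.instFinite (n : ℕ) : Finite (Tam n) :=
  ((BinaryTree.treesOfNumNodesEq n).finite_toSet.subset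
    (fun _ ht => BinaryTree.mem_treesOfNumNodesEq.2 ht) :
      {t : BinaryTree Unit | t.numNodes = n}.Finite).to_subtype

/-! ### Motzkin numbers -/

/-- The Motzkin numbers `1, 1, 2, 4, 9, 21, 51, …`, given by `M 0 = 1` and
`M (n + 1) = M n + ∑_{k < n} M k * M (n - 1 - k)`. -/
def motzkin : ℕ → ℕ
  | 0 => 1
  | n + 1 => motzkin n + ∑ k : Fin n, motzkin k * motzkin (n - 1 - k)

/-! Every internal edge of a tree carries exactly one rotation, upward at a right child and downward
at a left child, and rotations are exactly the covers (`Tam.covBy_iff`). So each element of the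
lattice has `n - 1` neighbours in its Hasse diagram. The exponent of `ybar` counts all lower covers
of `u`, and that of `x` only the upper covers lying below `v`; their sum is `n - 1` exactly when
every upper cover of `u` is below `v`. Dually for `v`. The intervals to be counted are therefore the
tight pairs (`Tam.degree_iff_tight`).

Tight pairs decompose. The order is the pointwise comparison of right-subtree sizes in infix order
(`reaches_iff`). Comparing left-subtree sizes as well, tightness forces `u = node () nil (node () l
r)`, and the leftmost vertex of `v` to have a right subtree `a` of the same size as `l`. Detaching
that vertex and `a` from `v` leaves `t`, and both `(l, a)` and `(node () nil r, t)` are tight. This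
is reversible (`Tight.graft`, `Tight.exists_eq_graft`), so the numbers `T` of tight pairs satisfy `T
(n + 2) = ∑ k ≤ n, T k * T (n + 1 - k)` with `T 0 = T 1 = 1`, which is the Motzkin recurrence for `T
(n + 1)`. -/

/-! ### Splitting lists and `List.Forall₂` along concatenations. -/

theorem List.forall₂_append_iff_of_length_eq {α β : Type*} {R : α → β → Prop} {a c : List α}
    {b d : List β} (h : a.length = b.length) :
    List.Forall₂ R (a ++ c) (b ++ d) ↔ List.Forall₂ R a b ∧ List.Forall₂ R c d := by
  induction a generalizing b with
  | nil =>
    obtain rfl : b = [] := List.length_eq_zero_iff.1 h.symm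
    simp
  | cons x a ih =>
    cases b with
    | nil => simp at h
    | cons y b =>
      simp only [List.length_cons, Nat.add_right_cancel_iff] at h
      simp [ih h, and_assoc]

theorem List.exists_append_of_forall₂_append_left {α β : Type*} {R : α → β → Prop} {a c : List α}
    {l : List β} (h : List.Forall₂ R (a ++ c) l) :
    ∃ b d, List.Forall₂ R a b ∧ List.Forall₂ R c d ∧ l = b ++ d := by
  have hl := h.length_eq
  rw [List.length_append] at hl
  rw [← List.take_append_drop a.length l,
    List.forall₂_append_iff_of_length_eq (by rw [List.length_take]; omega)] at h
  exact ⟨_, _, h.1, h.2, (List.take_append_drop _ _).symm⟩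

theorem List.Forall₂.trans_of_isTrans {α : Type*} {R : α → α → Prop} [IsTrans α R]
    {l₁ l₂ l₃ : List α} (h₁ : List.Forall₂ R l₁ l₂) (h₂ : List.Forall₂ R l₂ l₃) :
    List.Forall₂ R l₁ l₃ := by
  induction h₁ generalizing l₃ with
  | nil => exact h₂
  | cons h _ ih =>
    cases h₂ with
    | cons h' h₂ => exact .cons (_root_.trans h h') (ih h₂)

theorem List.append_cons_eq_append_cons {α : Type*} {A B l₁ l₂ : List α} {x m : α}
    (h : A ++ x :: B = l₁ ++ m :: l₂) :
    (∃ c, A = l₁ ++ m :: c ∧ l₂ = c ++ x :: B) ∨ (A = l₁ ∧ x = m ∧ B = l₂) ∨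
      ∃ c, l₁ = A ++ x :: c ∧ B = c ++ m :: l₂ := by
  rcases List.append_eq_append_iff.1 h with ⟨c, h₁, h₂⟩ | ⟨c, h₁, h₂⟩
  · cases c with
    | nil => simp_all
    | cons y c => simp_all
  · cases c with
    | nil => simp_all
    | cons y c => simp_all

/-! ### Vectors of subtree sizes. -/

namespace Tamari

open BinaryTree Relation

/-- The order relation of the Tamari lattices, on trees. -/
abbrev Reaches (s t : BinaryTree Unit) : Prop := ReflTransGen Rotation s t

/-- The sizes of the right subtrees of the vertices, in infix order. -/
def rightSizes : BinaryTree Unit → List ℕ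
  | nil => []
  | node _ a b => rightSizes a ++ b.numNodes :: rightSizes b

/-- The sizes of the left subtrees of the vertices, in infix order. -/
def leftSizes : BinaryTree Unit → List ℕ
  | nil => []
  | node _ a b => leftSizes a ++ a.numNodes :: leftSizes b

@[simp] theorem length_rightSizes (t : BinaryTree Unit) :
    (rightSizes t).length = t.numNodes := by
  induction t with
  | nil => rfl
  | node _ a b iha ihb =>
    simp only [rightSizes, List.length_append, List.length_cons, numNodes, iha, ihb]
    omega

@[simp] theorem length_leftSizes (t : BinaryTree Unit) : (leftSizes t).length = t.numNodes := by
  induction t with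
  | nil => rfl
  | node _ a b iha ihb =>
    simp only [leftSizes, List.length_append, List.length_cons, numNodes, iha, ihb]
    omega

theorem numNodes_eq_zero {t : BinaryTree Unit} : t.numNodes = 0 ↔ t = nil := by
  cases t <;> simp [numNodes]

theorem le_length_of_rightSizes_eq {t : BinaryTree Unit} {l₁ l₂ : List ℕ} {m : ℕ}
    (h : rightSizes t = l₁ ++ m :: l₂) : m ≤ l₂.length := by
  induction t generalizing l₁ l₂ with
  | nil => simp [rightSizes] at h
  | node _ a b iha ihb =>
    rcases List.append_cons_eq_append_cons h with ⟨c, h₁, rfl⟩ | ⟨-, rfl, rfl⟩ | ⟨c, rfl, h₂⟩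
    · have := iha h₁
      simp; omega
    · simp
    · exact ihb h₂

theorem le_length_of_leftSizes_eq {t : BinaryTree Unit} {l₁ l₂ : List ℕ} {m : ℕ}
    (h : leftSizes t = l₁ ++ m :: l₂) : m ≤ l₁.length := by
  induction t generalizing l₁ l₂ with
  | nil => simp [leftSizes] at h
  | node _ a b iha ihb =>
    rcases List.append_cons_eq_append_cons h with ⟨c, h₁, rfl⟩ | ⟨rfl, rfl, rfl⟩ | ⟨c, rfl, h₂⟩
    · exact iha h₁
    · simp
    · have := ihb h₂
      simp; omega

/-! ### The Tamari order in terms of the sizes of subtrees -/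

theorem Reaches.numNodes_eq {s t : BinaryTree Unit} (h : Reaches s t) :
    s.numNodes = t.numNodes := by
  induction h with
  | refl => rfl
  | tail _ h ih => exact ih.trans h.numNodes_eq

theorem Reaches.node {a a' b b' : BinaryTree Unit} (ha : Reaches a a') (hb : Reaches b b') :
    Reaches (node () a b) (node () a' b') :=
  (ha.lift (fun t => BinaryTree.node () t b) fun _ _ h => h.left b).trans
    (hb.lift (fun t => BinaryTree.node () a' t) fun _ _ h => h.right a')

theorem Rotation.rightSizes_ge {s t : BinaryTree Unit} (h : Rotation s t) :
    List.Forall₂ (· ≥ ·) (rightSizes s) (rightSizes t) := by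
  induction h with
  | root a b c =>
    simp only [rightSizes, List.append_assoc, List.cons_append]
    refine List.rel_append (List.forall₂_refl _) (.cons ?_ (List.forall₂_refl _))
    simp only [numNodes]; omega
  | left b _ ih => exact List.rel_append ih (List.forall₂_refl _)
  | right a h ih =>
    exact List.rel_append (List.forall₂_refl _) (.cons h.numNodes_eq.ge ih)

theorem Rotation.leftSizes_le {s t : BinaryTree Unit} (h : Rotation s t) :
    List.Forall₂ (· ≤ ·) (leftSizes s) (leftSizes t) := by
  induction h with
  | root a b c =>
    simp only [leftSizes, List.append_assoc, List.cons_append]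
    refine List.rel_append (List.forall₂_refl _) (.cons le_rfl
      (List.rel_append (List.forall₂_refl _) (.cons ?_ (List.forall₂_refl _))))
    simp only [numNodes]; omega
  | left b h ih => exact List.rel_append ih (.cons h.numNodes_eq.le (List.forall₂_refl _))
  | right a h ih => exact List.rel_append (List.forall₂_refl _) (.cons le_rfl ih)

theorem Reaches.rightSizes_ge {s t : BinaryTree Unit} (h : Reaches s t) :
    List.Forall₂ (· ≥ ·) (rightSizes s) (rightSizes t) := by
  induction h with
  | refl => exact List.forall₂_refl _
  | tail _ h ih => exact ih.trans_of_isTrans h.rightSizes_ge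

theorem Reaches.leftSizes_le {s t : BinaryTree Unit} (h : Reaches s t) :
    List.Forall₂ (· ≤ ·) (leftSizes s) (leftSizes t) := by
  induction h with
  | refl => exact List.forall₂_refl _
  | tail _ h ih => exact ih.trans_of_isTrans h.leftSizes_le

/-- A vertex of the rightmost branch can be brought to the root by rotations that shorten right
subtrees no more than necessary. -/
theorem exists_reaches_node {s : BinaryTree Unit} {l₁ l₂ l : List ℕ}
    (h : rightSizes s = l₁ ++ l₂.length :: l₂) (hl₁ : List.Forall₂ (· ≥ ·) l₁ l)
    (hl : ∀ k₁ m k₂, l = k₁ ++ m :: k₂ → m ≤ k₂.length) :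
    ∃ p q, Reaches s (node () p q) ∧ List.Forall₂ (· ≥ ·) (rightSizes p) l ∧
      rightSizes q = l₂ := by
  induction s generalizing l₁ l₂ l with
  | nil => simp [rightSizes] at h
  | node _ a b iha ihb =>
    rcases List.append_cons_eq_append_cons h with ⟨c, h₁, rfl⟩ | ⟨rfl, -, rfl⟩ | ⟨c, rfl, h₂⟩
    · have := le_length_of_rightSizes_eq h₁
      simp at this
    · exact ⟨a, b, .refl, hl₁, rfl⟩
    · obtain ⟨la, lb, ha, hb, rfl⟩ := List.exists_append_of_forall₂_append_left hl₁
      obtain ⟨y, lc, -, hc, rfl⟩ := List.forall₂_cons_left_iff.1 hb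
      obtain ⟨p, q, hpq, hp, hq⟩ :=
        ihb h₂ hc fun k₁ m k₂ hk => hl (la ++ y :: k₁) m k₂ (by simp [hk])
      refine ⟨node () a p, q, (Reaches.node .refl hpq).tail (.root a p q),
        List.rel_append ha (.cons ?_ hp), hq⟩
      -- The root of `s` keeps `p` as its right subtree, and `hl` bounds the required value `y` by
      -- `lc.length = p.numNodes`.
      have := hl la y lc rfl
      have := hp.length_eq
      simp at this ⊢
      omega

/-- Induction on `t`: the vertex of `s` in the infix position of the root of `t` is rotated to the
root, and the two sides are then compared separately. -/
theorem reaches_of_rightSizes_ge {s t : BinaryTree Unit}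
    (h : List.Forall₂ (· ≥ ·) (rightSizes s) (rightSizes t)) : Reaches s t := by
  induction t generalizing s with
  | nil =>
    have := h.length_eq
    rw [length_rightSizes, length_rightSizes] at this
    rw [numNodes_eq_zero.1 this]
  | node _ c d ihc ihd =>
    obtain ⟨l₁, l, h₁, h₂, hs⟩ := List.exists_append_of_forall₂_append_left (.flip h)
    obtain ⟨m, l₂, hm, h₃, rfl⟩ := List.forall₂_cons_left_iff.1 h₂
    replace h₁ := h₁.flip
    replace h₃ := h₃.flip
    have hm' := le_length_of_rightSizes_eq hs
    have hlen := h₃.length_eq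
    rw [length_rightSizes] at hlen
    -- The right subtree of this vertex contains everything after it, so the vertex lies on the
    -- rightmost branch of `s`.
    obtain rfl : m = l₂.length := by omega
    obtain ⟨p, q, hpq, hp, rfl⟩ := exists_reaches_node hs h₁
      fun _ _ _ hk => le_length_of_rightSizes_eq hk
    exact hpq.trans (Reaches.node (ihc hp) (ihd h₃))

theorem reaches_iff {s t : BinaryTree Unit} :
    Reaches s t ↔ List.Forall₂ (· ≥ ·) (rightSizes s) (rightSizes t) :=
  ⟨Reaches.rightSizes_ge, reaches_of_rightSizes_ge⟩

/-! ### Rotations at a given vertex -/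

/-- Undoing a rotation at a vertex with nonempty left subtree replaces that subtree by its own right
subtree and changes no other left subtree size. -/
theorem exists_rotation_of_leftSizes_eq {t : BinaryTree Unit} {l₁ l₂ : List ℕ} {m : ℕ}
    (h : leftSizes t = l₁ ++ m :: l₂) (hm : 0 < m) :
    ∃ t' m', Rotation t' t ∧ m' < m ∧ leftSizes t' = l₁ ++ m' :: l₂ := by
  induction t generalizing l₁ l₂ with
  | nil => simp [leftSizes] at h
  | node _ a b iha ihb =>
    rcases List.append_cons_eq_append_cons h with ⟨c, h₁, rfl⟩ | ⟨rfl, rfl, rfl⟩ | ⟨c, rfl, h₂⟩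
    · obtain ⟨t', m', ht, hm', h'⟩ := iha h₁
      exact ⟨_, m', ht.left b, hm', by simp [leftSizes, h', ht.numNodes_eq]⟩
    · cases a with
      | nil => simp [numNodes] at hm
      | node _ a c =>
        exact ⟨_, c.numNodes, .root a c b, by simp only [numNodes]; omega, by simp [leftSizes]⟩
    · obtain ⟨t', m', ht, hm', h'⟩ := ihb h₂
      exact ⟨_, m', ht.right a, hm', by simp [leftSizes, h']⟩

/-! ### Grafting at the leftmost leaf -/

/-- `graft t x` is `t` with its leftmost leaf replaced by `x`. -/
def graft : BinaryTree Unit → BinaryTree Unit → BinaryTree Unit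
  | nil, x => x
  | node _ a b, x => node () (graft a x) b

theorem rightSizes_graft (t x : BinaryTree Unit) :
    rightSizes (graft t x) = rightSizes x ++ rightSizes t := by
  induction t with
  | nil => simp [graft, rightSizes]
  | node _ a b ih _ => simp [graft, rightSizes, ih]

/-- The leftmost vertex of a nonempty tree is unique, hence so are its right subtree and the rest of
the tree. -/
theorem graft_injective {s t a b : BinaryTree Unit}
    (h : graft s (node () nil a) = graft t (node () nil b)) : s = t ∧ a = b := by
  have key : ∀ r c : BinaryTree Unit, graft r (node () nil c) ≠ nil := by
    intro r c; cases r <;> simp [graft]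
  induction s generalizing t with
  | nil =>
    cases t with
    | nil => simpa [graft] using h
    | node _ t₁ t₂ =>
      simp only [graft, node.injEq] at h
      exact absurd h.2.1.symm (key _ _)
  | node _ s₁ s₂ ih _ =>
    cases t with
    | nil =>
      simp only [graft, node.injEq] at h
      exact absurd h.2.1 (key _ _)
    | node _ t₁ t₂ =>
      simp only [graft, node.injEq] at h
      obtain ⟨rfl, rfl⟩ := ih h.2.1
      simp [h.2.2]

theorem exists_eq_graft {v : BinaryTree Unit} (hv : v ≠ nil) :
    ∃ t a, v = graft t (node () nil a) := by
  induction v with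
  | nil => exact absurd rfl hv
  | node _ a b ih _ =>
    by_cases ha : a = nil
    · exact ⟨nil, b, by rw [ha]; rfl⟩
    · obtain ⟨t, c, rfl⟩ := ih ha
      exact ⟨node () t b, c, rfl⟩

theorem Rotation.graft_left {s t : BinaryTree Unit} (h : Rotation s t) (x : BinaryTree Unit) :
    Rotation (graft s x) (graft t x) := by
  induction h with
  | root a b c => exact .root _ b c
  | left b _ ih => exact ih.left b
  | right a h _ => exact h.right _

theorem Rotation.graft_right {x y : BinaryTree Unit} (t : BinaryTree Unit) (h : Rotation x y) :
    Rotation (graft t x) (graft t y) := by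
  induction t with
  | nil => exact h
  | node _ a b ih _ => exact ih.left b

/-- The third case is the rotation at the junction, between the leftmost vertex and its parent. -/
theorem Rotation.cases_graft {w t a : BinaryTree Unit}
    (h : Rotation w (graft t (node () nil a))) :
    (∃ a', Rotation a' a ∧ w = graft t (node () nil a')) ∨
      (∃ t', Rotation t' t ∧ w = graft t' (node () nil a)) ∨
      ∃ r c, t = graft r (node () nil c) ∧ w = graft r (node () nil (node () a c)) := by
  induction t generalizing w with
  | nil =>
    cases h with
    | left _ h => cases h
    | right _ h => exact .inl ⟨_, h, rfl⟩
  | node _ t₁ t₂ ih _ =>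
    generalize hx : graft t₁ (node () nil a) = x at ih
    simp only [graft, hx] at h
    cases h with
    | root b c d =>
      cases t₁ with
      | nil =>
        simp only [graft, node.injEq, true_and] at hx
        obtain ⟨rfl, rfl⟩ := hx
        exact .inr (.inr ⟨nil, t₂, rfl, rfl⟩)
      | node _ t₁ t₃ =>
        simp only [graft, node.injEq, true_and] at hx
        obtain ⟨rfl, rfl⟩ := hx
        exact .inr (.inl ⟨_, .root t₁ t₃ t₂, rfl⟩)
    | left _ h =>
      rcases ih h with ⟨a', h', rfl⟩ | ⟨t', h', rfl⟩ | ⟨r, c, rfl, rfl⟩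
      · exact .inl ⟨a', h', rfl⟩
      · exact .inr (.inl ⟨_, h'.left t₂, rfl⟩)
      · exact .inr (.inr ⟨node () r t₂, c, rfl, rfl⟩)
    | right _ h =>
      subst hx
      exact .inr (.inl ⟨_, h.right t₁, rfl⟩)

/-- A maximal left size puts the vertex on the leftmost branch, and `0 < l₁.length` makes it differ
from the leftmost vertex. Here `x` and `y` are the subtrees of its left child; if `x` is empty, that
child is the leftmost vertex, with right subtree `a`. -/
theorem exists_rotation_of_leftSizes_graft_eq {t a : BinaryTree Unit} {l₁ l₂ : List ℕ}
    (h : leftSizes (graft t (node () nil a)) = l₁ ++ l₁.length :: l₂) (hl : 0 < l₁.length) :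
    ∃ w x y : BinaryTree Unit, Rotation w (graft t (node () nil a)) ∧
      leftSizes w = l₁ ++ y.numNodes :: l₂ ∧ x.numNodes + y.numNodes + 1 = l₁.length ∧
        (x = nil → y = a) := by
  induction t generalizing l₁ l₂ with
  | nil =>
    rcases List.append_cons_eq_append_cons (A := []) h with ⟨c, h₁, -⟩ | ⟨rfl, -⟩ | ⟨c, rfl, h₂⟩
    · simp at h₁
    · simp at hl
    · have := le_length_of_leftSizes_eq h₂
      simp at this
  | node _ t₁ t₂ ih _ =>
    rcases List.append_cons_eq_append_cons h with ⟨c, h₁, rfl⟩ | ⟨rfl, -, rfl⟩ | ⟨c, rfl, h₂⟩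
    · obtain ⟨w, x, y, hw, h', hxy, hx⟩ := ih h₁ hl
      refine ⟨node () w t₂, x, y, hw.left t₂, ?_, hxy, hx⟩
      simp only [leftSizes, h', hw.numNodes_eq, List.append_assoc, List.cons_append]
    · simp only [graft]
      generalize hz : graft t₁ (node () nil a) = z at hl ⊢
      cases z with
      | nil => simp [leftSizes] at hl
      | node _ x y =>
        refine ⟨_, x, y, .root x y t₂, by simp [leftSizes], by simp [numNodes], ?_⟩
        rintro rfl
        cases t₁ with
        | nil => simp_all [graft]
        | node _ t₁ t₃ =>
          simp only [graft, node.injEq] at hz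
          cases t₁ <;> simp [graft] at hz
    · have := le_length_of_leftSizes_eq h₂
      simp at this
      omega

/-- After the first entry, the right sizes are those of `l` and `node () nil r` on one side, of `a`
and `t` on the other; equal sizes align the blocks and make the first comparison automatic. -/
theorem reaches_graft_iff {l r t a : BinaryTree Unit} (h : l.numNodes = a.numNodes) :
    Reaches (node () nil (node () l r)) (graft t (node () nil a)) ↔
      Reaches l a ∧ Reaches (node () nil r) t := by
  simp only [reaches_iff, rightSizes_graft, rightSizes, List.nil_append, List.cons_append,
    List.forall₂_cons, numNodes]
  rw [List.forall₂_append_iff_of_length_eq (by simpa using h)]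
  exact and_iff_right (by omega)

/-- The pairs `(u, v)` with `u ≤ v` such that every tree that covers `u` is below `v` and every
tree that is covered by `v` is above `u`. -/
structure Tight (u v : BinaryTree Unit) : Prop where
  reaches : Reaches u v
  up : ∀ ⦃u'⦄, Rotation u u' → Reaches u' v
  down : ∀ ⦃v'⦄, Rotation v' v → Reaches u v'

/-! ### Decomposition of tight pairs. -/

theorem Tight.numNodes_eq {u v : BinaryTree Unit} (h : Tight u v) : u.numNodes = v.numNodes :=
  h.reaches.numNodes_eq

theorem tight_nil : Tight nil nil := ⟨.refl, fun _ h => (nomatch h), fun _ h => (nomatch h)⟩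

theorem tight_singleton : Tight (node () nil nil) (node () nil nil) := by
  refine ⟨.refl, fun _ h => ?_, fun _ h => ?_⟩ <;> cases h <;> rename_i h <;> cases h

theorem Tight.graft {l r t a : BinaryTree Unit} (h : Tight l a) (h' : Tight (node () nil r) t) :
    Tight (node () nil (node () l r)) (graft t (node () nil a)) := by
  refine ⟨(reaches_graft_iff h.numNodes_eq).2 ⟨h.reaches, h'.reaches⟩, fun u' hu => ?_,
    fun v' hv => ?_⟩
  · have hl := h.numNodes_eq
    cases hu with
    | root =>
      have h₁ := h.reaches
      have h₂ := h'.reaches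
      simp only [reaches_iff, rightSizes_graft, rightSizes, List.nil_append, List.cons_append,
        List.forall₂_cons] at h₁ h₂ ⊢
      exact ⟨hl.ge, List.rel_append h₁ h₂⟩
    | left _ h => cases h
    | right _ hu =>
      cases hu with
      | root _ b c =>
        have h₁ := h.reaches
        have h₂ := h'.up (.root nil b c)
        simp only [reaches_iff, rightSizes_graft, rightSizes, List.nil_append, List.cons_append,
          List.forall₂_cons, numNodes, List.append_assoc] at h₁ h₂ ⊢
        exact ⟨by omega, List.rel_append h₁ h₂⟩
      | left _ hu =>
        exact (reaches_graft_iff (hu.numNodes_eq.symm.trans hl)).2 ⟨h.up hu, h'.reaches⟩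
      | right _ hu => exact (reaches_graft_iff hl).2 ⟨h.reaches, h'.up (hu.right nil)⟩
  · rcases hv.cases_graft with ⟨a', ha, rfl⟩ | ⟨t', ht, rfl⟩ | ⟨s, c, rfl, rfl⟩
    · exact (reaches_graft_iff (h.numNodes_eq.trans ha.numNodes_eq.symm)).2
        ⟨h.down ha, h'.reaches⟩
    · exact (reaches_graft_iff h.numNodes_eq).2 ⟨h.reaches, h'.down ht⟩
    · have hl := h.numNodes_eq
      have h₁ := h.reaches
      have h₂ := h'.reaches
      simp only [reaches_iff, rightSizes_graft, rightSizes, List.nil_append, List.cons_append,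
        List.forall₂_cons, numNodes, List.append_assoc] at h₁ h₂ ⊢
      -- The junction rotation changes only the first right size, to `a.numNodes + c.numNodes + 1`,
      -- and `h₂.1` bounds the size of `c` by that of `r`.
      exact ⟨by omega, List.rel_append h₁ (.cons h₂.1 h₂.2)⟩

/-- The root of `u` has the largest left size possible at its infix position, so `v` has the same
value there. If it were positive, a tree covered by `v` would have a smaller one and could not be
above `u`. -/
theorem Tight.left_eq_nil {a b v : BinaryTree Unit} (h : Tight (node () a b) v) : a = nil := by
  obtain ⟨l₁, l, h₁, h₂, hv⟩ := List.exists_append_of_forall₂_append_left h.reaches.leftSizes_le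
  obtain ⟨m, l₂, hm, -, rfl⟩ := List.forall₂_cons_left_iff.1 h₂
  by_contra ha
  have ha' : 0 < a.numNodes := Nat.pos_of_ne_zero fun h => ha (numNodes_eq_zero.1 h)
  obtain ⟨v', m', hv', hm', hs⟩ := exists_rotation_of_leftSizes_eq hv (by omega)
  have h' := (h.down hv').leftSizes_le
  rw [hs, leftSizes, List.forall₂_append_iff_of_length_eq h₁.length_eq, List.forall₂_cons] at h'
  have := le_length_of_leftSizes_eq hv
  have := h₁.length_eq
  rw [length_leftSizes] at this
  omega

theorem Tight.numNodes_left_eq {l r t a : BinaryTree Unit}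
    (h : Tight (node () nil (node () l r)) (Tamari.graft t (node () nil a))) :
    l.numNodes = a.numNodes := by
  -- Rotating `u` at its root shrinks the first right size to that of `l`.
  have hal : a.numNodes ≤ l.numNodes := by
    have := h.up (.root nil l r)
    simp only [reaches_iff, rightSizes_graft, rightSizes, List.nil_append, List.cons_append,
      List.forall₂_cons] at this
    exact this.1
  refine le_antisymm ?_ hal
  by_contra! hlt
  have hu : leftSizes (node () nil (node () l r)) =
      (0 :: leftSizes l) ++ l.numNodes :: leftSizes r := rfl
  -- Left sizes can only grow above `u`; this is applied at the infix position of the root of `node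
  -- () l r`.
  have key : ∀ {s l₁ m l₂}, l₁.length = l.numNodes + 1 → leftSizes s = l₁ ++ m :: l₂ →
      Reaches (node () nil (node () l r)) s → l.numNodes ≤ m := by
    intro s l₁ m l₂ hl₁ hs h'
    have h' := h'.leftSizes_le
    rw [hs, hu, List.forall₂_append_iff_of_length_eq (by simp [hl₁]), List.forall₂_cons] at h'
    exact h'.2.1
  have h₀ := h.reaches.leftSizes_le
  rw [hu] at h₀
  obtain ⟨l₁, k, h₁, h₂, hv⟩ := List.exists_append_of_forall₂_append_left h₀
  obtain ⟨m, l₂, hm, -, rfl⟩ := List.forall₂_cons_left_iff.1 h₂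
  have hl₁ : l₁.length = l.numNodes + 1 := by simp [← h₁.length_eq]
  obtain ⟨v', m', hv', hm', hs⟩ := exists_rotation_of_leftSizes_eq hv (by omega)
  have := key hl₁ hs (h.down hv')
  have := le_length_of_leftSizes_eq hv
  -- Lowering `m` still leaves at least `l.numNodes`, so `m` takes its maximal value `l.numNodes +
  -- 1`.
  obtain rfl : m = l₁.length := by omega
  obtain ⟨w, x, y, hw, hs, hxy, hx⟩ := exists_rotation_of_leftSizes_graft_eq hv (by omega)
  have := key hl₁ hs (h.down hw)
  -- Now `y` has at least `l.numNodes` vertices, which leaves none for `x`; hence `y = a`, too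
  -- small.
  have := hx (numNodes_eq_zero.1 (by omega))
  subst this
  omega

theorem Tight.exists_eq_graft {u v : BinaryTree Unit} (h : Tight u v) (hu : 2 ≤ u.numNodes) :
    ∃ l r t a, Tight l a ∧ Tight (node () nil r) t ∧ u = node () nil (node () l r) ∧
      v = Tamari.graft t (node () nil a) := by
  obtain ⟨t, a, rfl⟩ : ∃ t a, v = Tamari.graft t (node () nil a) := by
    refine Tamari.exists_eq_graft ?_
    rintro rfl
    have := h.numNodes_eq
    simp only [numNodes] at this
    omega
  match u, hu, h with
  | nil, hu, _ => simp [numNodes] at hu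
  | node _ b nil, hu, h =>
    obtain rfl := h.left_eq_nil
    simp [numNodes] at hu
  | node _ b (node _ l r), _, h =>
    obtain rfl := h.left_eq_nil
    have hl := h.numNodes_left_eq
    have h₀ := (reaches_graft_iff hl).1 h.reaches
    refine ⟨l, r, t, a, ⟨h₀.1, fun l' hl' => ?_, fun a' ha' => ?_⟩,
      ⟨h₀.2, fun r' hr' => ?_, fun t' ht' => ?_⟩, rfl, rfl⟩
    · exact ((reaches_graft_iff (hl'.numNodes_eq.symm.trans hl)).1
        (h.up ((hl'.left r).right nil))).1
    · exact ((reaches_graft_iff (hl.trans ha'.numNodes_eq.symm)).1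
        (h.down ((ha'.right nil).graft_right t))).1
    · cases hr' with
      | left _ h => cases h
      | right _ hr => exact ((reaches_graft_iff hl).1 (h.up ((hr.right l).right nil))).2
      | root _ b c =>
        -- The root rotation of `node () nil r` corresponds in `u` to the rotation at `node () l r`:
        -- past the block of `l`, the right sizes agree.
        have h' := h.up ((Rotation.root l b c).right nil)
        simp only [reaches_iff, rightSizes_graft, rightSizes, List.nil_append, List.cons_append,
          List.forall₂_cons, List.append_assoc] at h' ⊢
        rw [List.forall₂_append_iff_of_length_eq (by simpa using hl)] at h'
        exact h'.2.2
    · exact ((reaches_graft_iff hl).1 (h.down (ht'.graft_left _))).2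

/-! ### Counting tight pairs -/

/-- The tight pairs of trees with `n` vertices. -/
def tightPairs (n : ℕ) : Set (BinaryTree Unit × BinaryTree Unit) :=
  {p | Tight p.1 p.2 ∧ p.1.numNodes = n}

theorem finite_numNodes_eq (n : ℕ) : {t : BinaryTree Unit | t.numNodes = n}.Finite :=
  (treesOfNumNodesEq n).finite_toSet.subset fun _ h => mem_treesOfNumNodesEq.2 h

instance (n : ℕ) : Finite (tightPairs n) :=
  (((finite_numNodes_eq n).prod (finite_numNodes_eq n)).subset fun _ h =>
    ⟨h.2, h.1.numNodes_eq.symm.trans h.2⟩).to_subtype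

theorem card_tightPairs_zero : Nat.card (tightPairs 0) = 1 := by
  have : tightPairs 0 = {(nil, nil)} := by
    ext ⟨u, v⟩
    simp only [tightPairs, Set.mem_ofPred_eq, Set.mem_singleton_iff, Prod.mk.injEq]
    constructor
    · rintro ⟨h, hu⟩
      exact ⟨numNodes_eq_zero.1 hu, numNodes_eq_zero.1 (h.numNodes_eq.symm.trans hu)⟩
    · rintro ⟨rfl, rfl⟩
      exact ⟨tight_nil, rfl⟩
  simp [this]

theorem numNodes_eq_one {t : BinaryTree Unit} : t.numNodes = 1 ↔ t = node () nil nil := by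
  rcases t with _ | ⟨_, a, b⟩ <;> simp [numNodes, numNodes_eq_zero]

theorem card_tightPairs_one : Nat.card (tightPairs 1) = 1 := by
  have : tightPairs 1 = {(node () nil nil, node () nil nil)} := by
    ext ⟨u, v⟩
    simp only [tightPairs, Set.mem_ofPred_eq, Set.mem_singleton_iff, Prod.mk.injEq]
    constructor
    · rintro ⟨h, hu⟩
      exact ⟨numNodes_eq_one.1 hu, numNodes_eq_one.1 (h.numNodes_eq.symm.trans hu)⟩
    · rintro ⟨rfl, rfl⟩
      exact ⟨tight_singleton, rfl⟩
  simp [this]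

/-- The tight pair obtained from two tight pairs, the second of which is not empty. -/
def glue (p q : BinaryTree Unit × BinaryTree Unit) : BinaryTree Unit × BinaryTree Unit :=
  (node () nil (node () p.1 q.1.right), graft q.2 (node () nil p.2))

theorem eq_node_right_of_mem_tightPairs {n : ℕ} {q : BinaryTree Unit × BinaryTree Unit}
    (hq : q ∈ tightPairs n) (hn : n ≠ 0) : q.1 = node () nil q.1.right := by
  obtain ⟨_ | ⟨_, a, b⟩, v⟩ := q
  · exact absurd hq.2.symm hn
  · obtain rfl := hq.1.left_eq_nil
    rfl

theorem glue_mem {n k : ℕ} (hk : k ≤ n) {p q : BinaryTree Unit × BinaryTree Unit}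
    (hp : p ∈ tightPairs k) (hq : q ∈ tightPairs (n + 1 - k)) : glue p q ∈ tightPairs (n + 2) := by
  have hr := eq_node_right_of_mem_tightPairs hq (by omega)
  have h₁ := hp.2
  have h₂ := hq.2
  rw [hr] at h₂
  refine ⟨hp.1.graft (hr ▸ hq.1), ?_⟩
  simp only [glue, numNodes] at h₂ ⊢
  omega

/-- The index `k` is the size of `l`. It stops at `n` because the second pair is nonempty. -/
theorem card_tightPairs_add_two (n : ℕ) :
    Nat.card (tightPairs (n + 2)) =
      ∑ k : Fin (n + 1), Nat.card (tightPairs k) * Nat.card (tightPairs (n + 1 - k)) := by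
  simp_rw [← Nat.card_prod]
  rw [← Nat.card_sigma]
  symm
  refine Nat.card_eq_of_bijective
    (fun x => ⟨glue x.2.1 x.2.2, glue_mem (Nat.le_of_lt_succ x.1.2) x.2.1.2 x.2.2.2⟩) ⟨?_, ?_⟩
  · rintro ⟨⟨k, hk⟩, ⟨⟨l, a⟩, hp⟩, ⟨⟨r, t⟩, hq⟩⟩ ⟨⟨k', hk'⟩, ⟨⟨l', a'⟩, hp'⟩, ⟨⟨r', t'⟩, hq'⟩⟩ h
    have hr := eq_node_right_of_mem_tightPairs hq (by simp only; omega)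
    have hr' := eq_node_right_of_mem_tightPairs hq' (by simp only; omega)
    simp only [glue, Subtype.mk.injEq, Prod.mk.injEq, node.injEq, true_and] at h hr hr'
    obtain ⟨⟨rfl, h⟩, h'⟩ := h
    obtain ⟨rfl, rfl⟩ := graft_injective h'
    obtain rfl : r = r' := by rw [hr, hr', h]
    obtain rfl : k = k' := hp.2.symm.trans hp'.2
    rfl
  · rintro ⟨⟨u, v⟩, h, hn⟩
    obtain ⟨l, r, t, a, h₁, h₂, rfl, rfl⟩ := h.exists_eq_graft ((Nat.le_add_left 2 n).trans hn.ge)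
    simp only [numNodes] at hn
    refine ⟨⟨⟨l.numNodes, by omega⟩, ⟨(l, a), h₁, rfl⟩, ⟨(node () nil r, t), h₂, ?_⟩⟩, rfl⟩
    simp only [numNodes]
    omega

theorem card_tightPairs_succ (n : ℕ) : Nat.card (tightPairs (n + 1)) = motzkin n := by
  induction n using Nat.strong_induction_on with
  | _ n ih =>
    cases n with
    | zero => rw [card_tightPairs_one, motzkin]
    | succ n =>
      rw [card_tightPairs_add_two, Fin.sum_univ_succ, motzkin]
      congr 1
      -- The empty first pair gives the isolated term `motzkin n`; the other indices are shifted by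
      -- one.
      · simp only [Fin.val_zero, card_tightPairs_zero, one_mul, Nat.sub_zero]
        exact ih n (by omega)
      · refine Finset.sum_congr rfl fun k _ => ?_
        have h : n + 1 - k.succ = n - 1 - k + 1 := by simp; omega
        rw [h, ih _ (by omega), Fin.val_succ, ih _ (by omega)]

/-! ### Covering relations -/

theorem Rotation.not_reaches {s t : BinaryTree Unit} (h : Rotation s t) : ¬ Reaches t s := by
  intro h'
  have := h.leftWeight_lt
  rcases eq_or_leftWeight_lt h' with rfl | h' <;> omega

theorem Rotation.ne {s t : BinaryTree Unit} (h : Rotation s t) : s ≠ t := by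
  rintro rfl
  exact h.not_reaches .refl

theorem reaches_node_iff {a b c d : BinaryTree Unit} (h : a.numNodes = c.numNodes) :
    Reaches (node () a b) (node () c d) ↔ Reaches a c ∧ Reaches b d := by
  simp only [reaches_iff, rightSizes]
  rw [List.forall₂_append_iff_of_length_eq (by simpa using h), List.forall₂_cons]
  refine and_congr_right fun _ => and_iff_right_of_imp fun h => ?_
  simpa using h.length_eq.ge

/-- Rotations of one tree form an antichain: for rotations at different places, `Reaches w t` would
make a right size grow or undo a rotation in a subtree. -/
theorem Rotation.eq_of_reaches {s w t : BinaryTree Unit} (hw : Rotation s w) (ht : Rotation s t)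
    (h : Reaches w t) : w = t := by
  induction hw generalizing t with
  | root a b c =>
    have key : ∀ {a' d}, a.numNodes = a'.numNodes → (node () b c).numNodes = d.numNodes →
        ¬ Reaches (node () (node () a b) c) (node () a' d) := by
      intro a' d ha hd h
      simp only [reaches_iff, rightSizes, List.append_assoc, List.cons_append] at h
      rw [List.forall₂_append_iff_of_length_eq (by simpa using ha), List.forall₂_cons] at h
      simp only [numNodes] at hd
      omega
    cases ht with
    | root => rfl
    | left _ ht => exact absurd h (key ht.numNodes_eq rfl)
    | right _ ht => exact absurd h (key rfl ht.numNodes_eq)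
  | left b ha ih =>
    cases ht with
    | root _ b c =>
      simp only [reaches_iff, rightSizes, List.append_assoc, List.cons_append] at h
      rw [List.forall₂_append_iff_of_length_eq (by simpa using ha.numNodes_eq.symm)] at h
      exact absurd (reaches_iff.2 h.1) ha.not_reaches
    | left _ ht =>
      rw [ih ht ((reaches_node_iff (ha.numNodes_eq.symm.trans ht.numNodes_eq)).1 h).1]
    | right _ ht => exact absurd ((reaches_node_iff ha.numNodes_eq.symm).1 h).1 ha.not_reaches
  | right a hb ih =>
    cases ht with
    | root _ b c =>
      simp only [reaches_iff, rightSizes, List.append_assoc, List.cons_append] at h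
      rw [List.forall₂_append_iff_of_length_eq rfl, List.forall₂_cons] at h
      exact absurd (reaches_iff.2 h.2.2) hb.not_reaches
    | left _ ht => exact absurd ((reaches_node_iff ht.numNodes_eq).1 h).2 hb.not_reaches
    | right _ ht => rw [ih ht ((reaches_node_iff rfl).1 h).2]

theorem finite_setOf_rotation (s : BinaryTree Unit) : {t | Rotation s t}.Finite :=
  (finite_numNodes_eq s.numNodes).subset fun _ h => (Rotation.numNodes_eq h).symm

theorem finite_setOf_rotation' (s : BinaryTree Unit) : {t | Rotation t s}.Finite :=
  (finite_numNodes_eq s.numNodes).subset fun _ h => Rotation.numNodes_eq h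

theorem ncard_image_node_union {a b : BinaryTree Unit} {A B : Set (BinaryTree Unit)}
    (hA : A.Finite) (hB : B.Finite) (ha : a ∉ A) :
    ((fun t => node () t b) '' A ∪ (fun t => node () a t) '' B).ncard = A.ncard + B.ncard := by
  rw [Set.ncard_union_eq _ (hA.image _) (hB.image _),
    Set.ncard_image_of_injective _ fun _ _ h => by simpa using h,
    Set.ncard_image_of_injective _ fun _ _ h => by simpa using h]
  rw [Set.disjoint_left]
  rintro _ ⟨t, ht, rfl⟩ ⟨t', _, h⟩
  simp only [node.injEq, true_and] at h
  exact ha (h.1 ▸ ht)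

theorem ncard_rotation_node_nil (a : BinaryTree Unit) :
    {t | Rotation (node () a nil) t}.ncard = {t | Rotation a t}.ncard := by
  rw [← Set.ncard_image_of_injective {t | Rotation a t} (f := fun t => node () t nil)
    fun _ _ h => by simpa using h]
  congr 1
  ext t
  constructor
  · rintro (_ | ⟨_, h⟩ | ⟨_, ⟨⟩⟩)
    exact ⟨_, h, rfl⟩
  · rintro ⟨t, h, rfl⟩
    exact .left _ h

theorem ncard_rotation_nil_node (b : BinaryTree Unit) :
    {t | Rotation t (node () nil b)}.ncard = {t | Rotation t b}.ncard := by
  rw [← Set.ncard_image_of_injective {t | Rotation t b} (f := fun t => node () nil t)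
    fun _ _ h => by simpa using h]
  congr 1
  ext t
  constructor
  · rintro (_ | ⟨_, ⟨⟩⟩ | ⟨_, h⟩)
    exact ⟨_, h, rfl⟩
  · rintro ⟨t, h, rfl⟩
    exact .right _ h

theorem ncard_rotation_node_node (a b c : BinaryTree Unit) :
    {t | Rotation (node () a (node () b c)) t}.ncard =
      {t | Rotation a t}.ncard + {t | Rotation (node () b c) t}.ncard + 1 := by
  rw [← ncard_image_node_union (b := node () b c) (finite_setOf_rotation a)
    (finite_setOf_rotation _) fun h => Rotation.ne h rfl, ← Set.ncard_insert_of_notMem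
      (a := node () (node () a b) c) _
      (((finite_setOf_rotation _).image _).union ((finite_setOf_rotation _).image _))]
  · congr 1
    ext t
    constructor
    · rintro (_ | ⟨_, h⟩ | ⟨_, h⟩)
      · exact .inl rfl
      · exact .inr (.inl ⟨_, h, rfl⟩)
      · exact .inr (.inr ⟨_, h, rfl⟩)
    · rintro (rfl | ⟨t, h, rfl⟩ | ⟨t, h, rfl⟩)
      · exact .root a b c
      · exact .left _ h
      · exact .right _ h
  · rintro (⟨t, -, h⟩ | ⟨t, -, h⟩)
    · have := congrArg (fun t => t.right.numNodes) h
      simp only [right, numNodes] at this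
      omega
    · have := congrArg (fun t => t.left.numNodes) h
      simp only [left, numNodes] at this
      omega

theorem ncard_rotation_node_node' (a b c : BinaryTree Unit) :
    {t | Rotation t (node () (node () a b) c)}.ncard =
      {t | Rotation t (node () a b)}.ncard + {t | Rotation t c}.ncard + 1 := by
  rw [← ncard_image_node_union (a := node () a b) (b := c) (finite_setOf_rotation' _)
    (finite_setOf_rotation' _) fun h => Rotation.ne h rfl, ← Set.ncard_insert_of_notMem
      (a := node () a (node () b c)) _
      (((finite_setOf_rotation' _).image _).union ((finite_setOf_rotation' _).image _))]
  · congr 1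
    ext t
    constructor
    · rintro (_ | ⟨_, h⟩ | ⟨_, h⟩)
      · exact .inl rfl
      · exact .inr (.inl ⟨_, h, rfl⟩)
      · exact .inr (.inr ⟨_, h, rfl⟩)
    · rintro (rfl | ⟨t, h, rfl⟩ | ⟨t, h, rfl⟩)
      · exact .root a b c
      · exact .left _ h
      · exact .right _ h
  · rintro (⟨t, -, h⟩ | ⟨t, -, h⟩)
    · have := congrArg (fun t => t.right.numNodes) h
      simp only [right, numNodes] at this
      omega
    · have := congrArg (fun t => t.left.numNodes) h
      simp only [left, numNodes] at this
      omega

/-- Each vertex other than the root accounts for one rotation: upward if it is a right child,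
downward if it is a left child. -/
theorem ncard_rotation_add_ncard_rotation (s : BinaryTree Unit) :
    {t | Rotation s t}.ncard + {t | Rotation t s}.ncard = s.numNodes - 1 := by
  induction s with
  | nil =>
    have h₁ : {t | Rotation nil t} = ∅ := Set.eq_empty_of_forall_notMem fun _ h => nomatch h
    have h₂ : {t | Rotation t nil} = ∅ := Set.eq_empty_of_forall_notMem fun _ h => nomatch h
    simp [h₁, h₂, numNodes]
  | node _ a b iha ihb =>
    -- With truncated subtraction the last summand is `1` if `b` is nonempty and `0` otherwise.
    have up : {t | Rotation (node () a b) t}.ncard = {t | Rotation a t}.ncard +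
        {t | Rotation b t}.ncard + (b.numNodes - (b.numNodes - 1)) := by
      cases b with
      | nil =>
        have h : {t | Rotation nil t} = ∅ := Set.eq_empty_of_forall_notMem fun _ h => nomatch h
        rw [ncard_rotation_node_nil, h]
        simp [numNodes]
      | node _ b c =>
        rw [ncard_rotation_node_node]
        simp [numNodes]
    have down : {t | Rotation t (node () a b)}.ncard = {t | Rotation t a}.ncard +
        {t | Rotation t b}.ncard + (a.numNodes - (a.numNodes - 1)) := by
      cases a with
      | nil =>
        have h : {t | Rotation t nil} = ∅ := Set.eq_empty_of_forall_notMem fun _ h => nomatch h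
        rw [ncard_rotation_nil_node, h]
        simp [numNodes]
      | node _ a c =>
        rw [ncard_rotation_node_node']
        simp [numNodes]
    simp only [up, down, numNodes]
    omega

end Tamari

/-! ### Covers in the Tamari lattice. -/

namespace Tam
open Tamari Relation

variable {n : ℕ}

/-- A cover is the first rotation of a chain from `s` to `t`; conversely nothing lies strictly
between, since rotations of `s` are pairwise incomparable. -/
theorem covBy_iff {s t : Tam n} : s ⋖ t ↔ Rotation s.1 t.1 := by
  have lt_of_rotation : ∀ {s t : Tam n}, Rotation s.1 t.1 → s < t := fun h =>
    lt_of_le_not_ge (ReflTransGen.single h) h.not_reaches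
  have exists_rotation : ∀ {s t : Tam n}, s < t → ∃ w : Tam n, Rotation s.1 w.1 ∧ w ≤ t := by
    intro s t h
    rcases ReflTransGen.cases_head h.le with h' | ⟨w, hw, hwt⟩
    · exact absurd (Subtype.ext h') h.ne
    · exact ⟨⟨w, hw.numNodes_eq.symm.trans s.2⟩, hw, hwt⟩
  constructor
  · intro h
    obtain ⟨w, hw, hwt⟩ := exists_rotation h.lt
    rcases hwt.eq_or_lt with rfl | hwt
    · exact hw
    · exact absurd hwt (h.2 (lt_of_rotation hw))
  · refine fun h => ⟨lt_of_rotation h, fun w hsw hwt => ?_⟩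
    obtain ⟨w', hw', hle⟩ := exists_rotation hsw
    have := hw'.eq_of_reaches h (hle.trans hwt.le)
    exact absurd (Subtype.ext this ▸ hle) hwt.not_ge

theorem ncard_covBy_add_ncard_covBy (s : Tam n) :
    {t | s ⋖ t}.ncard + {t | t ⋖ s}.ncard = n - 1 := by
  have h := ncard_rotation_add_ncard_rotation s.1
  rw [s.2] at h
  rw [← h, ← Set.ncard_image_of_injective {t | s ⋖ t} Subtype.val_injective,
    ← Set.ncard_image_of_injective {t | t ⋖ s} Subtype.val_injective]
  congr 2 <;> ext t <;> simp only [Set.mem_ofPred_eq, covBy_iff]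
  · exact ⟨fun ⟨w, hw, h⟩ => h ▸ hw, fun h => ⟨⟨t, h.numNodes_eq.symm.trans s.2⟩, h, rfl⟩⟩
  · exact ⟨fun ⟨w, hw, h⟩ => h ▸ hw, fun h => ⟨⟨t, h.numNodes_eq.trans s.2⟩, h, rfl⟩⟩

end Tam

/-! ### Exponents as numbers of covers of the two ends. -/

namespace IntervalPoset

variable {P : Type*} [PartialOrder P]

theorem covBy_of_lo_covBy {I J : IntervalPoset P} (h : I.lo ⋖ J.lo) (h' : J.hi = I.hi) :
    I ⋖ J := by
  have hIJ : I ≤ J := ⟨h.le, h'.ge⟩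
  refine ⟨lt_of_le_of_ne hIJ fun e => h.ne (by rw [e]), fun K hIK hKJ => ?_⟩
  have hhi : K.hi = I.hi := le_antisymm (hKJ.le.2.trans h'.le) hIK.le.2
  refine h.2 (lt_of_le_of_ne hIK.le.1 fun e => ?_) (lt_of_le_of_ne hKJ.le.1 fun e => ?_)
  · exact hIK.ne (Subtype.ext (Prod.ext e hhi.symm))
  · exact hKJ.ne (Subtype.ext (Prod.ext e (hhi.trans h'.symm)))

theorem covBy_of_hi_covBy {I J : IntervalPoset P} (h : I.hi ⋖ J.hi) (h' : J.lo = I.lo) :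
    I ⋖ J := by
  have hIJ : I ≤ J := ⟨h'.ge, h.le⟩
  refine ⟨lt_of_le_of_ne hIJ fun e => h.ne (by rw [e]), fun K hIK hKJ => ?_⟩
  have hlo : K.lo = I.lo := le_antisymm (hKJ.le.1.trans h'.le) hIK.le.1
  refine h.2 (lt_of_le_of_ne hIK.le.2 fun e => ?_) (lt_of_le_of_ne hKJ.le.2 fun e => ?_)
  · exact hIK.ne (Subtype.ext (Prod.ext hlo.symm e))
  · exact hKJ.ne (Subtype.ext (Prod.ext (hlo.trans h'.symm) e))

theorem ncard_setOf_hi_eq (I : IntervalPoset P) (p : P → Prop) :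
    {J : IntervalPoset P | p J.lo ∧ J.hi = I.hi}.ncard = {u | p u ∧ u ≤ I.hi}.ncard := by
  refine Set.ncard_congr (fun J _ => J.lo) (fun J h => ⟨h.1, h.2 ▸ J.2⟩) ?_ ?_
  · exact fun J K hJ hK h => Subtype.ext (Prod.ext h (hJ.2.trans hK.2.symm))
  · exact fun u hu => ⟨⟨(u, I.hi), hu.2⟩, ⟨hu.1, rfl⟩, rfl⟩

theorem ncard_setOf_lo_eq (I : IntervalPoset P) (p : P → Prop) :
    {J : IntervalPoset P | J.lo = I.lo ∧ p J.hi}.ncard = {v | p v ∧ I.lo ≤ v}.ncard := by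
  refine Set.ncard_congr (fun J _ => J.hi) (fun J h => ⟨h.2, h.1 ▸ J.2⟩) ?_ ?_
  · exact fun J K hJ hK h => Subtype.ext (Prod.ext (hJ.1.trans hK.1.symm) h)
  · exact fun v hv => ⟨⟨(I.lo, v), hv.2⟩, ⟨rfl, hv.1⟩, rfl⟩

theorem exponent_x (I : IntervalPoset P) :
    I.exponent .x = {u | I.lo ⋖ u ∧ u ≤ I.hi}.ncard := by
  rw [← ncard_setOf_hi_eq I (I.lo ⋖ ·)]
  refine congrArg Set.ncard (Set.ext fun J => ?_)
  exact and_iff_right_of_imp fun h => covBy_of_lo_covBy h.1 h.2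

/-- Moving the lower end down always leaves an interval, so no bound by `I.hi` remains, unlike for
`x`. -/
theorem exponent_ybar (I : IntervalPoset P) : I.exponent .ybar = {u | u ⋖ I.lo}.ncard := by
  have h : {u | u ⋖ I.lo} = {u | u ⋖ I.lo ∧ u ≤ I.hi} :=
    Set.ext fun u => (and_iff_left_of_imp fun h => h.le.trans I.2).symm
  rw [h, ← ncard_setOf_hi_eq I (· ⋖ I.lo)]
  refine congrArg Set.ncard (Set.ext fun J => ?_)
  exact and_iff_right_of_imp fun h => covBy_of_lo_covBy h.1 h.2.symm

theorem exponent_xbar (I : IntervalPoset P) :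
    I.exponent .xbar = {v | v ⋖ I.hi ∧ I.lo ≤ v}.ncard := by
  rw [← ncard_setOf_lo_eq I (· ⋖ I.hi)]
  refine congrArg Set.ncard (Set.ext fun J => ?_)
  exact and_iff_right_of_imp fun h => covBy_of_hi_covBy h.2 h.1.symm

theorem exponent_y (I : IntervalPoset P) : I.exponent .y = {v | I.hi ⋖ v}.ncard := by
  have h : {v | I.hi ⋖ v} = {v | I.hi ⋖ v ∧ I.lo ≤ v} :=
    Set.ext fun v => (and_iff_left_of_imp fun h => I.2.trans h.le).symm
  rw [h, ← ncard_setOf_lo_eq I (I.hi ⋖ ·)]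
  refine congrArg Set.ncard (Set.ext fun J => ?_)
  exact and_iff_right_of_imp fun h => covBy_of_hi_covBy h.2 h.1

end IntervalPoset

theorem Set.ncard_setOf_and_eq_iff {α : Type*} [Finite α] {p q : α → Prop} :
    {a | p a ∧ q a}.ncard = {a | p a}.ncard ↔ ∀ a, p a → q a := by
  constructor
  · intro h a ha
    exact (Set.eq_of_subset_of_ncard_le (fun _ h => h.1) h.ge ▸ ha : a ∈ {a | p a ∧ q a}).2
  · intro h
    congr 1
    ext a
    exact and_iff_left_of_imp (h a)

/-! ### Degree conditions and tightness. -/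

namespace Tam
open Tamari

variable {n : ℕ}

/-- Once the lower covers of `I.lo` are cancelled, the equality says that all its upper covers are
counted by `x`. -/
theorem degree_lo_iff (I : IntervalPoset (Tam n)) :
    I.degree {.x, .ybar} = n - 1 ↔ ∀ u, I.lo ⋖ u → u ≤ I.hi := by
  rw [IntervalPoset.degree, Finset.sum_pair (by decide), IntervalPoset.exponent_x,
    IntervalPoset.exponent_ybar, ← ncard_covBy_add_ncard_covBy I.lo, Nat.add_right_cancel_iff,
    Set.ncard_setOf_and_eq_iff]

theorem degree_hi_iff (I : IntervalPoset (Tam n)) :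
    I.degree {.xbar, .y} = n - 1 ↔ ∀ v, v ⋖ I.hi → I.lo ≤ v := by
  rw [IntervalPoset.degree, Finset.sum_pair (by decide), IntervalPoset.exponent_xbar,
    IntervalPoset.exponent_y, ← ncard_covBy_add_ncard_covBy I.hi,
    Nat.add_comm {t | I.hi ⋖ t}.ncard, Nat.add_right_cancel_iff, Set.ncard_setOf_and_eq_iff]

theorem degree_iff_tight (I : IntervalPoset (Tam n)) :
    (I.degree {.x, .ybar} = n - 1 ∧ I.degree {.xbar, .y} = n - 1) ↔ Tight I.lo.1 I.hi.1 := by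
  rw [degree_lo_iff, degree_hi_iff]
  simp only [covBy_iff]
  constructor
  · rintro ⟨h₁, h₂⟩
    exact ⟨I.2, fun u hu => h₁ ⟨u, hu.numNodes_eq.symm.trans I.lo.2⟩ hu,
      fun v hv => h₂ ⟨v, hv.numNodes_eq.trans I.hi.2⟩ hv⟩
  · exact fun h => ⟨fun u hu => h.up hu, fun v hv => h.down hv⟩

end Tam

theorem mainTheorem6 (n : ℕ) (hn : 1 ≤ n) :
    {I : IntervalPoset (Tam n) |
      I.degree {.x, .ybar} = n - 1 ∧ I.degree {.xbar, .y} = n - 1}.ncard = motzkin (n - 1) := by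
  obtain ⟨n, rfl⟩ := Nat.exists_eq_add_of_le' hn
  rw [Nat.add_sub_cancel, ← Tamari.card_tightPairs_succ]
  refine Set.ncard_congr (fun I _ => (I.lo.1, I.hi.1))
    (fun I hI => ⟨(Tam.degree_iff_tight I).1 hI, I.lo.2⟩) ?_ ?_
  · intro I J _ _ h
    simp only [Prod.mk.injEq] at h
    exact Subtype.ext (Prod.ext (Subtype.ext h.1) (Subtype.ext h.2))
  · rintro ⟨u, v⟩ ⟨h, hu⟩
    exact ⟨⟨(⟨u, hu⟩, ⟨v, h.numNodes_eq.symm.trans hu⟩), h.reaches⟩,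
      (Tam.degree_iff_tight _).2 h, rfl⟩
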